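/- **Conventions.** Complexes are finite abstract simplicial complexes; the empty simplex (of dimension $-1$) is counted as a simplex. $S_d(K)$ is the set of $d$-dimensional simplices, and $F\in\partial\bar F$ means that $F$ is a codimension-one face of $\bar F$. Face weights $w$ are positive reals on all simplices, and $C^d$ carries the inner product $\langle f,g\rangle=\sum_{F\in S_d}w(F)f([F])\overline{g([F])}$. For nonzero complex weights $\omega(F,\bar F)$ on the incidences $F\in\partial\bar F$ put $$(\delta^\omega_{d} f)([v_0,\dots,v_{d+1}])=\sum_{j}(-1)^j\,\omega(\{v_0,\dots,\hat v_j,\dots,v_{d+1}\},\{v_0,\dots,v_{d+1}\})\,f([v_0,\dots,\hat v_j,\dots,v_{d+1}]),$$ and $\mathcal L_i^{\mathrm{down}}(M,\omega)=\delta^\omega_{i-1}(\delta^\omega_{i-1})^*$ on $C^i(M,\mathbb C)$; $\mathcal L_i^{\mathrm{down}}(K)$ is the case $\omega\equiv1$ on real cochains. $\operatorname{Spec}$ is the multiset of eigenvalues with algebraic multiplicity. A *covering* $\phi:K\to M$ is a simplicial map with $K$ connected such that for each $G\in M$ the simplices $F\in K$ with $\phi(F)=G$ are pairwise disjoint, are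 mapped bijectively onto $G$, and together contain all vertices of $K$ lying over $G$, and such that whenever $G\in\partial\bar G$ in $M$ and $\phi(F)=G$ there is $\bar F\in K$ with $F\in\partial\bar F$ and $\phi(\bar F)=\bar G$ (strong covering). It is *$k$-fold* ($k\ge1$) if over each nonempty simplex of $M$ there are exactly $k$ simplices of $K$. $B_{i-1}(K)$ is the bipartite graph on $S_{i-1}(K)\cup S_i(K)$ with edges $\{F,\bar F\}$ for $F\in\partial\bar F$. A permutation assignment $\psi$ on $B_{i-1}(M)$ gives each arc $e$ an element of the symmetric group $\mathbb S_k$ with $\psi(e^{-1})=\psi(e)^{-1}$; the derived graph $B_{i-1}(M)^\psi$ has vertices $(u,a)$, $a\in[k]$, and $(u,a)\sim(v,b)$ iff $\{u,v\}$ is an edge and $a=\psi(u,v)(b)$. **Theorem.** Let $i\ge0$, let $\phi:K\to M$ be a $k$-fold covering, and let $w_K(F)=w_M(\phi(F))$ for all $F\in S_{i-1}(K)\cup S_i(K)$. Let $\psi$ be a permutation assignment on $B_{i-1}(M)$ with an isomorphism $\eta:B_{i-1}(M)^\psi\to B_{i-1}(K)$ satisfying $\phi(\eta(G,a))=G$ for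 all $(G,a)$, and suppose that the voltage group $\Psi_{i-1}=\langle\psi(G,\bar G): G\in\partial\bar G,\ \bar G\in S_i(M)\rangle\le\mathbb S_k$ is abelian. Then the permutation representation $\varrho$ of $\Psi_{i-1}$ on $\mathbb C^k$ has a decomposition $\varrho=1\oplus\varrho_2\oplus\cdots\oplus\varrho_k$ into representations of degree one, and for every such decomposition, as multisets, $$\operatorname{Spec}\mathcal L_i^{\mathrm{down}}(K)=\operatorname{Spec}\mathcal L_i^{\mathrm{down}}(M)\ \cup\ \bigcup_{j=2}^k\operatorname{Spec}\mathcal L_i^{\mathrm{down}}(M,\omega_j),\qquad \omega_j(F,\bar F)=\varrho_j(\psi(F,\bar F))\ \text{ for } F\in\partial\bar F,\ \bar F\in S_i(M).$$ -/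

import Mathlib

open Finset

noncomputable section

namespace CoverSpec

/-! ### Faces of a finite complex, the empty face included -/

section Faces

variable {V : Type*} [Fintype V] [DecidableEq V]

/-- The simplices of `K`, where the empty simplex always counts as one (of dimension `-1`).
Mathlib's complexes list the nonempty simplices only. -/
def IsFace (K : PreAbstractSimplicialComplex V) (F : Finset V) : Prop := F = ∅ ∨ F ∈ K

theorem IsFace.mono {K : PreAbstractSimplicialComplex V} {F G : Finset V} (hG : IsFace K G)
    (h : F ⊆ G) : IsFace K F := by
  rcases F.eq_empty_or_nonempty with h0 | h0
  · exact Or.inl h0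
  · rcases hG with rfl | hG
    · exact Or.inl (Finset.subset_empty.1 h)
    · exact Or.inr ((K.isRelLowerSet_faces hG).2 h h0)

/-- The faces of `K` with `n` vertices, that is, the `(n - 1)`-dimensional faces
`S_{n-1}(K)`. -/
def Face (K : PreAbstractSimplicialComplex V) (n : ℕ) : Type _ :=
  {F : Finset V // IsFace K F ∧ F.card = n}

instance (K : PreAbstractSimplicialComplex V) (n : ℕ) : Fintype (Face K n) := by
  classical exact inferInstanceAs (Fintype {F : Finset V // IsFace K F ∧ F.card = n})

instance (K : PreAbstractSimplicialComplex V) (n : ℕ) : DecidableEq (Face K n) :=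
  inferInstanceAs (DecidableEq {F : Finset V // IsFace K F ∧ F.card = n})

/-- The ordered `(n - 1)`-simplices `[v_0, …, v_{n-1}]` of `K`. -/
def OrdSimplex (K : PreAbstractSimplicialComplex V) (n : ℕ) : Type _ :=
  {v : Fin n → V // Function.Injective v ∧ IsFace K (univ.image v)}

instance (K : PreAbstractSimplicialComplex V) (n : ℕ) : Fintype (OrdSimplex K n) := by
  classical exact inferInstanceAs
    (Fintype {v : Fin n → V // Function.Injective v ∧ IsFace K (univ.image v)})

instance (K : PreAbstractSimplicialComplex V) (n : ℕ) : DecidableEq (OrdSimplex K n) :=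
  inferInstanceAs
    (DecidableEq {v : Fin n → V // Function.Injective v ∧ IsFace K (univ.image v)})

variable {K : PreAbstractSimplicialComplex V} {n : ℕ}

/-- The underlying face of an ordered simplex. -/
def OrdSimplex.face (v : OrdSimplex K n) : Face K n :=
  ⟨univ.image v.1, v.2.2, by rw [card_image_of_injective _ v.2.1, card_univ, Fintype.card_fin]⟩

/-- Reordering the vertices of an ordered simplex. -/
def OrdSimplex.reorder (v : OrdSimplex K n) (σ : Equiv.Perm (Fin n)) : OrdSimplex K n :=
  ⟨v.1 ∘ σ, v.2.1.comp σ.injective, v.2.2.mono (by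
    intro x hx
    obtain ⟨a, -, rfl⟩ := Finset.mem_image.1 hx
    exact Finset.mem_image_of_mem _ (mem_univ _))⟩

/-- The ordered simplex `[v_0, …, v̂_j, …, v_n]`. -/
def OrdSimplex.omit_vertex (v : OrdSimplex K (n + 1)) (j : Fin (n + 1)) : OrdSimplex K n :=
  ⟨v.1 ∘ j.succAbove, v.2.1.comp Fin.succAbove_right_injective, v.2.2.mono (by
    intro x hx
    obtain ⟨a, -, rfl⟩ := Finset.mem_image.1 hx
    exact Finset.mem_image_of_mem _ (mem_univ _))⟩

/-- An ordering of the vertices of a face (some chosen orientation `[F]`). -/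
def Face.oriented (F : Face K n) : OrdSimplex K n :=
  ⟨fun a => ((F.1.equivFinOfCardEq F.2.2).symm a : V),
    fun _ _ h => (F.1.equivFinOfCardEq F.2.2).symm.injective (Subtype.ext h),
    F.2.1.mono (by
      intro x hx
      obtain ⟨a, -, rfl⟩ := Finset.mem_image.1 hx
      exact ((F.1.equivFinOfCardEq F.2.2).symm a).2)⟩

theorem OrdSimplex.face_reorder (v : OrdSimplex K n) (σ : Equiv.Perm (Fin n)) :
    (v.reorder σ).face = v.face := by
  apply Subtype.ext
  ext x
  simp only [OrdSimplex.face, OrdSimplex.reorder, Finset.mem_image, mem_univ, true_and,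
    Function.comp_apply]
  exact ⟨fun ⟨a, h⟩ => ⟨σ a, h⟩, fun ⟨a, h⟩ => ⟨σ.symm a, by simpa using h⟩⟩

theorem Face.face_oriented (F : Face K n) : F.oriented.face = F := by
  apply Subtype.ext
  ext x
  simp only [OrdSimplex.face, Face.oriented, Finset.mem_image, mem_univ, true_and]
  constructor
  · rintro ⟨a, rfl⟩
    exact ((F.1.equivFinOfCardEq F.2.2).symm a).2
  · intro hx
    exact ⟨F.1.equivFinOfCardEq F.2.2 ⟨x, hx⟩, by simp⟩

theorem OrdSimplex.face_omit_subset (v : OrdSimplex K (n + 1)) (j : Fin (n + 1)) :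
    (v.omit_vertex j).face.1 ⊆ v.face.1 := by
  intro x hx
  obtain ⟨a, -, rfl⟩ := Finset.mem_image.1 hx
  exact Finset.mem_image_of_mem _ (mem_univ _)

end Faces

/-! ### Cochains, coboundary, adjoint, Laplacian -/

section Laplacian

variable {V : Type*} [Fintype V] [DecidableEq V]

/-- The cochain group `C^{n-1}(K, 𝕜)`: functions on ordered `(n - 1)`-simplices that change by
the sign of the permutation when the vertices are reordered. -/
def Cochain (𝕜 : Type*) [RCLike 𝕜] (K : PreAbstractSimplicialComplex V) (n : ℕ) :
    Submodule 𝕜 (OrdSimplex K n → 𝕜) where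
  carrier := {f | ∀ v σ, f (v.reorder σ) = ((Equiv.Perm.sign σ : ℤ) : 𝕜) * f v}
  zero_mem' := by intro v σ; simp
  add_mem' := by
    intro f g hf hg v σ
    simp only [Pi.add_apply, hf v σ, hg v σ, mul_add]
  smul_mem' := by
    intro c f hf v σ
    simp only [Pi.smul_apply, smul_eq_mul, hf v σ]
    ring

/-- Weights on the incidences between `(n - 1)`-faces and `n`-faces: nonzero when `F ∈ ∂ F̄` and
zero otherwise. An incidence-weighted complex carries such weights in every dimension; its down
Laplacian on `n`-cochains involves only these ones. -/
structure IncidenceWeight (𝕜 : Type*) [RCLike 𝕜] (K : PreAbstractSimplicialComplex V)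
    (n : ℕ) where
  toFun : Face K n → Face K (n + 1) → 𝕜
  ne_zero : ∀ F G, F.1 ⊆ G.1 → toFun F G ≠ 0
  eq_zero : ∀ F G, ¬ F.1 ⊆ G.1 → toFun F G = 0

/-- All incidences have weight `1`; this gives the ordinary complex. -/
def IncidenceWeight.one (𝕜 : Type*) [RCLike 𝕜] (K : PreAbstractSimplicialComplex V) (n : ℕ) :
    IncidenceWeight 𝕜 K n where
  toFun F G := if F.1 ⊆ G.1 then 1 else 0
  ne_zero F G h := by simp [h]
  eq_zero F G h := by simp [h]

variable {𝕜 : Type*} [RCLike 𝕜] {K : PreAbstractSimplicialComplex V} {n : ℕ}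

/-- The extension of a permutation of `{0, …, n-1}` to `{0, …, n}` that fixes `0` and acts on
the successors. -/
def extendPerm (τ : Equiv.Perm (Fin n)) : Equiv.Perm (Fin (n + 1)) :=
  Equiv.Perm.decomposeFin.symm (0, τ)

theorem extendPerm_zero (τ : Equiv.Perm (Fin n)) : extendPerm τ 0 = 0 := by
  simp [extendPerm]

theorem extendPerm_succ (τ : Equiv.Perm (Fin n)) (a : Fin n) :
    extendPerm τ a.succ = (τ a).succ := by
  simp [extendPerm]

theorem sign_extendPerm (τ : Equiv.Perm (Fin n)) :
    Equiv.Perm.sign (extendPerm τ) = Equiv.Perm.sign τ := by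
  simp [extendPerm, Equiv.Perm.decomposeFin.symm_sign]

theorem omit_reorder_extendPerm (v : OrdSimplex K (n + 1)) (τ : Equiv.Perm (Fin n)) :
    (v.reorder (extendPerm τ)).omit_vertex 0 = (v.omit_vertex 0).reorder τ := by
  apply Subtype.ext
  funext a
  simp [OrdSimplex.reorder, OrdSimplex.omit_vertex, extendPerm_succ]

/-- Omitting a vertex after a reordering, up to a reordering of known sign. -/
theorem exists_omit_reorder (σ : Equiv.Perm (Fin (n + 1))) (j : Fin (n + 1)) :
    ∃ τ : Equiv.Perm (Fin n),
      (∀ v : OrdSimplex K (n + 1),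
        (v.reorder σ).omit_vertex j = (v.omit_vertex (σ j)).reorder τ) ∧
      ((-1 : ℤ) ^ (j : ℕ)) * (Equiv.Perm.sign τ : ℤ) =
        (Equiv.Perm.sign σ : ℤ) * (-1 : ℤ) ^ (σ j : ℕ) := by
  have h0 : ((σ j).cycleRange * σ * j.cycleRange.symm : Equiv.Perm (Fin (n + 1))) 0 = 0 := by
    simp [Equiv.Perm.mul_apply, Fin.cycleRange_symm_zero]
  obtain ⟨⟨p, τ⟩, hτ⟩ := Equiv.Perm.decomposeFin.symm.surjective
    ((σ j).cycleRange * σ * j.cycleRange.symm : Equiv.Perm (Fin (n + 1)))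
  have hp : p = 0 := by
    rw [← hτ, Equiv.Perm.decomposeFin_symm_apply_zero] at h0
    exact h0
  subst hp
  change extendPerm τ = _ at hτ
  refine ⟨τ, fun v => ?_, ?_⟩
  · apply Subtype.ext
    funext a
    have h1 := congrArg (fun e : Equiv.Perm (Fin (n + 1)) => (σ j).cycleRange.symm (e a.succ)) hτ
    simp only [extendPerm_succ, Equiv.Perm.mul_apply, Fin.cycleRange_symm_succ,
      Equiv.symm_apply_apply] at h1
    simp [OrdSimplex.reorder, OrdSimplex.omit_vertex, h1]
  · have h2 := congrArg (fun e => (Equiv.Perm.sign e : ℤ)) hτ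
    simp only [sign_extendPerm, Equiv.Perm.sign_mul, Equiv.Perm.sign_symm, Fin.sign_cycleRange,
      Units.val_mul, Units.val_pow_eq_pow_val, Units.val_neg, Units.val_one] at h2
    rw [h2]
    have h3 : ((-1 : ℤ) ^ (j : ℕ)) * ((-1 : ℤ) ^ (j : ℕ)) = 1 := by
      rw [← mul_pow]; norm_num
    linear_combination ((-1 : ℤ) ^ (σ j : ℕ)) * (Equiv.Perm.sign σ : ℤ) * h3

/-- The weighted coboundary map `C^{n-1} → C^n`,
`(δ^ω f)[v_0, …, v_n] = ∑_j (-1)^j ω(F_j, F̄) f[v_0, …, v̂_j, …, v_n]`. -/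
def coboundary (ω : IncidenceWeight 𝕜 K n) : Cochain 𝕜 K n →ₗ[𝕜] Cochain 𝕜 K (n + 1) where
  toFun f := ⟨fun v => ∑ j : Fin (n + 1),
      (-1 : 𝕜) ^ (j : ℕ) * ω.toFun (v.omit_vertex j).face v.face * f.1 (v.omit_vertex j), by
    intro v σ
    rw [Finset.mul_sum]
    rw [← Equiv.sum_comp σ (fun j => ((Equiv.Perm.sign σ : ℤ) : 𝕜) * ((-1 : 𝕜) ^ (j : ℕ) *
      ω.toFun (v.omit_vertex j).face v.face * f.1 (v.omit_vertex j)))]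
    refine Finset.sum_congr rfl fun j _ => ?_
    obtain ⟨τ, h1, h2⟩ := exists_omit_reorder (K := K) σ j
    rw [h1 v, f.2 _ τ, OrdSimplex.face_reorder, OrdSimplex.face_reorder]
    have h3 := congrArg (fun z : ℤ => (z : 𝕜)) h2
    push_cast at h3
    linear_combination ω.toFun (v.omit_vertex (σ j)).face v.face *
      f.1 (v.omit_vertex (σ j)) * h3⟩
  map_add' f g := by
    apply Subtype.ext
    funext v
    simp [mul_add, Finset.sum_add_distrib]
  map_smul' c f := by
    apply Subtype.ext
    funext v
    simp only [Submodule.coe_smul, Pi.smul_apply, smul_eq_mul, RingHom.id_apply, Finset.mul_sum]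
    exact Finset.sum_congr rfl fun j _ => by ring

/-- The inner product `⟨f, g⟩ = ∑_F w(F) f([F]) conj(g([F]))` on cochains. -/
def cochainInner (w : Finset V → ℝ) (f g : Cochain 𝕜 K n) : 𝕜 :=
  ∑ F : Face K n, (w F.1 : 𝕜) * f.1 F.oriented * (starRingEnd 𝕜) (g.1 F.oriented)

/-- The map `C^n → C^{n-1}` adjoint to `coboundary ω` for the inner products `cochainInner w`
(see `coboundary_adjoint`). The sum is over the ordered simplices `[u, v_0, …, v_{n-1}]`. -/
def adjointCoboundary (w : Finset V → ℝ) (ω : IncidenceWeight 𝕜 K n) :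
    Cochain 𝕜 K (n + 1) →ₗ[𝕜] Cochain 𝕜 K n where
  toFun g := ⟨fun v => ∑ x : OrdSimplex K (n + 1) with x.omit_vertex 0 = v,
      ((w x.face.1 / w v.face.1 : ℝ) : 𝕜) * (starRingEnd 𝕜) (ω.toFun v.face x.face) * g.1 x, by
    intro v σ
    rw [Finset.mul_sum]
    symm
    refine Finset.sum_bij' (fun x _ => x.reorder (extendPerm σ))
      (fun x _ => x.reorder (extendPerm σ⁻¹)) ?_ ?_ ?_ ?_ ?_
    · intro x hx
      simp only [Finset.mem_filter, mem_univ, true_and] at hx ⊢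
      rw [omit_reorder_extendPerm, hx]
    · intro x hx
      simp only [Finset.mem_filter, mem_univ, true_and] at hx ⊢
      rw [omit_reorder_extendPerm, hx]
      apply Subtype.ext
      funext a
      simp [OrdSimplex.reorder]
    · intro x _
      apply Subtype.ext
      funext a
      refine Fin.cases ?_ (fun b => ?_) a <;>
        simp [OrdSimplex.reorder, extendPerm_zero, extendPerm_succ]
    · intro x _
      apply Subtype.ext
      funext a
      refine Fin.cases ?_ (fun b => ?_) a <;>
        simp [OrdSimplex.reorder, extendPerm_zero, extendPerm_succ]
    · intro x _
      rw [g.2 x (extendPerm σ), OrdSimplex.face_reorder, OrdSimplex.face_reorder,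
        sign_extendPerm]
      ring⟩
  map_add' f g := by
    apply Subtype.ext
    funext v
    simp [mul_add, Finset.sum_add_distrib]
  map_smul' c f := by
    apply Subtype.ext
    funext v
    simp only [Submodule.coe_smul, Pi.smul_apply, smul_eq_mul, RingHom.id_apply, Finset.mul_sum]
    exact Finset.sum_congr rfl fun j _ => by ring

/-- Any two orderings of a face differ by a unique reordering. -/
theorem exists_reorder (v x : OrdSimplex K n) (h : x.face = v.face) :
    ∃ σ : Equiv.Perm (Fin n), v.reorder σ = x := by
  have hmem : ∀ a, ∃ b, v.1 b = x.1 a := by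
    intro a
    have : x.1 a ∈ v.face.1 := by
      rw [← h]; exact Finset.mem_image_of_mem _ (mem_univ _)
    obtain ⟨b, -, hb⟩ := Finset.mem_image.1 this
    exact ⟨b, hb⟩
  choose s hs using hmem
  have hinj : Function.Injective s := fun a b hab => x.2.1 (by rw [← hs a, ← hs b, hab])
  refine ⟨Equiv.ofBijective s (Finite.injective_iff_bijective.1 hinj), ?_⟩
  apply Subtype.ext
  funext a
  exact hs a

/-- A sum over ordered simplices of a quantity that does not see the ordering. -/
theorem sum_ordSimplex (h : OrdSimplex K n → 𝕜) (hh : ∀ v σ, h (v.reorder σ) = h v) :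
    ∑ v, h v = (Nat.factorial n : 𝕜) * ∑ F : Face K n, h F.oriented := by
  rw [Finset.mul_sum, ← Finset.sum_fiberwise (s := univ) (g := fun v : OrdSimplex K n => v.face)]
  refine Finset.sum_congr rfl fun F _ => ?_
  have : ∑ v : OrdSimplex K n with v.face = F, h v =
      ∑ _σ : Equiv.Perm (Fin n), h F.oriented := by
    symm
    refine Finset.sum_bij (fun σ _ => F.oriented.reorder σ) ?_ ?_ ?_ ?_
    · intro σ _
      simp [OrdSimplex.face_reorder, Face.face_oriented]
    · intro σ _ τ _ he
      ext a
      have := congrFun (congrArg Subtype.val he) a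
      exact congrArg _ (F.oriented.2.1 this)
    · intro x hx
      simp only [Finset.mem_filter, mem_univ, true_and] at hx
      obtain ⟨σ, hσ⟩ := exists_reorder F.oriented x (by rw [hx, Face.face_oriented])
      exact ⟨σ, mem_univ _, hσ⟩
    · intro σ _
      exact (hh _ _).symm
  rw [this, Finset.sum_const, card_univ, Fintype.card_perm, Fintype.card_fin, nsmul_eq_mul]

theorem sign_mul_self (σ : Equiv.Perm (Fin n)) :
    ((Equiv.Perm.sign σ : ℤ) : 𝕜) * ((Equiv.Perm.sign σ : ℤ) : 𝕜) = 1 := by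
  rcases Int.units_eq_one_or (Equiv.Perm.sign σ) with h | h <;> simp [h]

theorem factorial_mul_cochainInner (w : Finset V → ℝ) (f g : Cochain 𝕜 K n) :
    (Nat.factorial n : 𝕜) * cochainInner w f g =
      ∑ v : OrdSimplex K n, (w v.face.1 : 𝕜) * f.1 v * (starRingEnd 𝕜) (g.1 v) := by
  rw [sum_ordSimplex]
  · simp only [cochainInner, Face.face_oriented]
  · intro v σ
    rw [OrdSimplex.face_reorder, f.2 v σ, g.2 v σ, map_mul, map_intCast]
    linear_combination (w v.face.1 : 𝕜) * f.1 v * (starRingEnd 𝕜) (g.1 v) *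
      sign_mul_self (𝕜 := 𝕜) σ

/-- `adjointCoboundary w ω` is the adjoint of `coboundary ω`. -/
theorem coboundary_adjoint (w : Finset V → ℝ) (hw : ∀ F, IsFace K F → 0 < w F)
    (ω : IncidenceWeight 𝕜 K n) (f : Cochain 𝕜 K n) (g : Cochain 𝕜 K (n + 1)) :
    cochainInner w (coboundary ω f) g = cochainInner w f (adjointCoboundary w ω g) := by
  set S : 𝕜 := ∑ x : OrdSimplex K (n + 1), (w x.face.1 : 𝕜) *
    ω.toFun (x.omit_vertex 0).face x.face * f.1 (x.omit_vertex 0) * (starRingEnd 𝕜) (g.1 x)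
    with hS
  have h1 : (Nat.factorial (n + 1) : 𝕜) * cochainInner w (coboundary ω f) g = (n + 1 : 𝕜) * S := by
    rw [factorial_mul_cochainInner]
    simp only [coboundary, LinearMap.coe_mk, AddHom.coe_mk, Finset.mul_sum, Finset.sum_mul]
    rw [Finset.sum_comm]
    have : ∀ j : Fin (n + 1), ∑ x : OrdSimplex K (n + 1), (w x.face.1 : 𝕜) * ((-1) ^ (j : ℕ) *
        ω.toFun (x.omit_vertex j).face x.face * f.1 (x.omit_vertex j)) *
          (starRingEnd 𝕜) (g.1 x) = S := by
      intro j
      symm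
      refine Finset.sum_bij' (fun x _ => x.reorder j.cycleRange)
        (fun x _ => x.reorder j.cycleRange.symm) ?_ ?_ ?_ ?_ ?_
      · simp
      · simp
      · intro x _
        apply Subtype.ext; funext a; simp [OrdSimplex.reorder]
      · intro x _
        apply Subtype.ext; funext a; simp [OrdSimplex.reorder]
      · intro x _
        have h0 : (x.reorder j.cycleRange).omit_vertex j = x.omit_vertex 0 := by
          apply Subtype.ext
          funext a
          simp [OrdSimplex.reorder, OrdSimplex.omit_vertex]
        rw [h0, OrdSimplex.face_reorder, g.2 x, Fin.sign_cycleRange, map_mul, map_intCast]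
        have h3 : ((-1 : 𝕜) ^ (j : ℕ)) * ((-1 : 𝕜) ^ (j : ℕ)) = 1 := by
          rw [← mul_pow]; norm_num
        push_cast
        linear_combination -(w x.face.1 : 𝕜) * ω.toFun (x.omit_vertex 0).face x.face *
          f.1 (x.omit_vertex 0) * (starRingEnd 𝕜) (g.1 x) * h3
    rw [Finset.sum_congr rfl fun j _ => this j]
    simp
  have h2 : (Nat.factorial n : 𝕜) * cochainInner w f (adjointCoboundary w ω g) = S := by
    rw [factorial_mul_cochainInner, hS,
      ← Finset.sum_fiberwise (s := univ) (g := fun x : OrdSimplex K (n + 1) => x.omit_vertex 0)]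
    refine Finset.sum_congr rfl fun v _ => ?_
    simp only [adjointCoboundary, LinearMap.coe_mk, AddHom.coe_mk, map_sum, Finset.mul_sum]
    refine Finset.sum_congr rfl fun x hx => ?_
    simp only [Finset.mem_filter, mem_univ, true_and] at hx
    subst hx
    have hne : (w (x.omit_vertex 0).face.1 : 𝕜) ≠ 0 := by
      exact_mod_cast (hw _ (x.omit_vertex 0).face.2.1).ne'
    simp only [map_mul, RCLike.conj_ofReal, RCLike.conj_conj]
    push_cast
    field_simp
  have hn : (Nat.factorial n : 𝕜) ≠ 0 := by exact_mod_cast Nat.factorial_ne_zero n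
  have hn1 : (n + 1 : 𝕜) ≠ 0 := by exact_mod_cast Nat.succ_ne_zero n
  rw [← h2, Nat.factorial_succ] at h1
  push_cast at h1
  rw [mul_assoc] at h1
  exact mul_left_cancel₀ hn (mul_left_cancel₀ hn1 h1)

variable (K) in
/-- The `i`-down Laplace operator `δ_{i-1}^ω (δ_{i-1}^ω)^*` of the incidence-weighted complex
`(K, ω)` with face weights `w`, acting on `C^i(K, 𝕜)`. -/
def weightedDownLaplacian (i : ℕ) (w : Finset V → ℝ) (ω : IncidenceWeight 𝕜 K i) :
    Module.End 𝕜 (Cochain 𝕜 K (i + 1)) :=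
  coboundary ω ∘ₗ adjointCoboundary w ω

/-- The `i`-down Laplace operator `δ_{i-1} δ_{i-1}^*` of `K` with face weights `w`, acting on
`C^i(K, ℝ)`. -/
def downLaplacian (K : PreAbstractSimplicialComplex V) (i : ℕ) (w : Finset V → ℝ) :
    Module.End ℝ (Cochain ℝ K (i + 1)) :=
  weightedDownLaplacian K i w (IncidenceWeight.one ℝ K i)

/-- The spectrum of an operator as a multiset: the complex roots of its characteristic
polynomial with their multiplicities. -/
def spec [Algebra 𝕜 ℂ] {E : Type*} [AddCommGroup E] [Module 𝕜 E] [Module.Finite 𝕜 E]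
    [Module.Free 𝕜 E] (A : Module.End 𝕜 E) : Multiset ℂ :=
  (LinearMap.charpoly A).aroots ℂ

end Laplacian

/-! ### Coverings -/

section Covering

variable {V W : Type*} [Fintype V] [DecidableEq V] [Fintype W] [DecidableEq W]

/-- The graph on the vertices of `K` formed by the edges (the `1`-skeleton). -/
def skeletonGraph (K : PreAbstractSimplicialComplex V) : SimpleGraph {v : V // {v} ∈ K} where
  Adj u v := u ≠ v ∧ ({u.1, v.1} : Finset V) ∈ K
  symm := ⟨fun u v h => ⟨h.1.symm, by rw [Finset.pair_comm]; exact h.2⟩⟩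
  loopless := ⟨fun _ h => h.1 rfl⟩

/-- `φ : K → M` is a (strong) covering. Only the values of `φ` at vertices of `K` matter. -/
structure IsCovering (K : PreAbstractSimplicialComplex V) (M : PreAbstractSimplicialComplex W)
    (φ : V → W) : Prop where
  connected : (skeletonGraph K).Connected
  simplicial : ∀ F, IsFace K F → IsFace M (F.image φ)
  /-- Every simplex of `K` over a simplex `G` of `M` is mapped bijectively onto `G`. -/
  bijOn : ∀ G, IsFace M G → ∀ F, IsFace K F → F.image φ = G → Set.BijOn φ F G
  /-- Distinct simplices of `K` over the same simplex of `M` are disjoint. -/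
  disjoint : ∀ G, IsFace M G → ∀ F F', IsFace K F → IsFace K F' → F.image φ = G →
    F'.image φ = G → F ≠ F' → Disjoint F F'
  /-- The simplices of `K` over `G` exhaust the vertices of `K` over `G`. -/
  exhaust : ∀ G, IsFace M G → ∀ v, {v} ∈ K → φ v ∈ G → ∃ F, IsFace K F ∧ F.image φ = G ∧ v ∈ F
  /-- Strongness: a simplex `F` over a facet `G` of `G'` extends to a simplex over `G'`. -/
  lift : ∀ G G', IsFace M G → IsFace M G' → G ⊆ G' → G'.card = G.card + 1 →
    ∀ F, IsFace K F → F.image φ = G →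
      ∃ F', IsFace K F' ∧ F ⊆ F' ∧ F'.card = F.card + 1 ∧ F'.image φ = G'

/-- `φ : K → M` is a `k`-fold covering: over every nonempty simplex of `M` there are exactly `k`
simplices of `K`. -/
structure IsFoldCovering (k : ℕ) (K : PreAbstractSimplicialComplex V)
    (M : PreAbstractSimplicialComplex W) (φ : V → W) : Prop extends IsCovering K M φ where
  degree : ∀ G ∈ M, Set.ncard {F : Finset V | F ∈ K ∧ F.image φ = G} = k

end Covering

/-! ### Incidence graphs, voltages and derived graphs -/

section Voltage

variable {V : Type*} [Fintype V] [DecidableEq V]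

/-- The incidence graph `B_{n-1}(K)` on `S_{n-1}(K) ∪ S_n(K)`, with an edge `{F, F̄}` whenever
`F ∈ ∂ F̄`. -/
def incidenceGraph (K : PreAbstractSimplicialComplex V) (n : ℕ) :
    SimpleGraph (Face K n ⊕ Face K (n + 1)) where
  Adj
    | .inl F, .inr G => F.1 ⊆ G.1
    | .inr G, .inl F => F.1 ⊆ G.1
    | _, _ => False
  symm := ⟨by rintro (F | F) (G | G) h <;> exact h⟩
  loopless := ⟨by rintro (F | F) h <;> exact h⟩

/-- The simplex that a vertex of the incidence graph stands for. -/
def simplexOf {K : PreAbstractSimplicialComplex V} {n : ℕ} :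
    Face K n ⊕ Face K (n + 1) → Finset V
  | .inl F => F.1
  | .inr F => F.1

/-- A permutation voltage assignment on the arcs of a simple graph, with
`ψ(e⁻¹) = ψ(e)⁻¹`. -/
structure Voltage {X : Type*} (B : SimpleGraph X) (k : ℕ) where
  toFun : B.Dart → Equiv.Perm (Fin k)
  map_symm : ∀ d, toFun d.symm = (toFun d)⁻¹

/-- The derived graph `B^ψ` on `V(B) × [k]`: `(u, a)` and `(v, b)` are adjacent if `{u, v}` is an
edge of `B` and `a = ψ(u, v)(b)`. -/
def derivedGraph {X : Type*} {B : SimpleGraph X} {k : ℕ} (ψ : Voltage B k) :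
    SimpleGraph (X × Fin k) where
  Adj x y := ∃ h : B.Adj x.1 y.1, x.2 = ψ.toFun ⟨(x.1, y.1), h⟩ y.2
  symm := ⟨by
    rintro x y ⟨h, hxy⟩
    refine ⟨h.symm, ?_⟩
    have := ψ.map_symm ⟨(x.1, y.1), h⟩
    change ψ.toFun ⟨(y.1, x.1), h.symm⟩ = _ at this
    rw [this, hxy]
    exact (Equiv.symm_apply_apply _ _).symm⟩
  loopless := ⟨fun x h => B.loopless.irrefl x.1 h.1⟩

variable {M : PreAbstractSimplicialComplex V} {n k : ℕ}

/-- The permutation `ψ(F, F̄)` of an incidence `F ∈ ∂ F̄`. -/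
def Voltage.incidence (ψ : Voltage (incidenceGraph M n) k) (F : Face M n) (G : Face M (n + 1))
    (h : F.1 ⊆ G.1) : Equiv.Perm (Fin k) :=
  ψ.toFun ⟨(.inl F, .inr G), h⟩

/-- The voltage group `Ψ_{n-1}`, generated by the permutations `ψ(F, F̄)`. -/
def Voltage.group (ψ : Voltage (incidenceGraph M n) k) : Subgroup (Equiv.Perm (Fin k)) :=
  Subgroup.closure {g | ∃ F G, ∃ h : F.1 ⊆ G.1, g = ψ.incidence F G h}

/-- The incidence weights `ω(F, F̄) = χ(ψ(F, F̄))` for a degree-one representation `χ` of the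
voltage group. -/
def Voltage.weight (ψ : Voltage (incidenceGraph M n) k) (χ : ψ.group →* ℂˣ) :
    IncidenceWeight ℂ M n where
  toFun F G := if h : F.1 ⊆ G.1 then
    (χ ⟨ψ.incidence F G h, Subgroup.subset_closure ⟨F, G, h, rfl⟩⟩ : ℂ) else 0
  ne_zero F G h := by simp [h]
  eq_zero F G h := by simp [h]

/-- The matrix `P^g`, with `(a, b)` entry `1` if `a = g b` and `0` otherwise. -/
def permMat {k : ℕ} (g : Equiv.Perm (Fin k)) : Matrix (Fin k) (Fin k) ℂ :=
  Matrix.of fun a b => if a = g b then 1 else 0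

/-- The permutation representation `g ↦ P^g` of `H` decomposes as the direct sum of the degree-one
representations `ϱ 0, …, ϱ (k-1)`, the first of which is trivial. -/
def IsDecomposition {k : ℕ} [NeZero k] (H : Subgroup (Equiv.Perm (Fin k)))
    (ϱ : Fin k → (H →* ℂˣ)) : Prop :=
  ϱ 0 = 1 ∧ ∃ T : Matrix (Fin k) (Fin k) ℂ, IsUnit T ∧
    ∀ g : H, T⁻¹ * permMat (g : Equiv.Perm (Fin k)) * T =
      Matrix.diagonal fun j => (ϱ j g : ℂ)

end Voltage

end CoverSpec

end

/-!
The isomorphism `η` labels the simplices of `K` of the two dimensions involved by a simplex of `M`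
and a sheet in `[k]`. A cochain of `K` is thus a `k`-tuple of cochains of `M`, one for each sheet,
and passing to a facet moves the sheet by a permutation in the voltage group. Since that group is
finite and abelian, its characters diagonalise the permutation action. Recombining the sheets by a
diagonalising matrix turns the coboundary of `K` into the direct sum of the coboundaries of `M`
weighted by `ω_j`. The characters take values of modulus one, so the same recombination carries
the adjoint of the coboundary to the adjoints of these; it therefore conjugates the down Laplacian
of `K` to the direct sum of the weighted ones of `M`.
-/

noncomputable section

namespace CoverSpec

open scoped Matrix

section LinearAlgebra

theorem charpoly_pi {ι R E : Type*} [Fintype ι] [Field R] [Infinite R]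
    [AddCommGroup E] [Module R E] [Module.Finite R E] (A : ι → Module.End R E) :
    LinearMap.charpoly (LinearMap.pi fun j => A j ∘ₗ LinearMap.proj j : Module.End R (ι → E)) =
      ∏ j, (A j).charpoly := by
  refine Polynomial.funext fun t => ?_
  rw [Polynomial.eval_prod, LinearMap.eval_charpoly]
  simp only [LinearMap.eval_charpoly]
  rw [← LinearMap.det_pi]
  rfl

theorem spec_pi {ι E : Type*} [Fintype ι] [AddCommGroup E] [Module ℂ E] [Module.Finite ℂ E]
    (A : ι → Module.End ℂ E) :
    spec (LinearMap.pi fun j => A j ∘ₗ LinearMap.proj j : Module.End ℂ (ι → E)) =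
      ∑ j, spec (A j) := by
  simp only [spec, charpoly_pi, Polynomial.aroots, Polynomial.map_prod]
  exact Polynomial.roots_prod _ _
    (Finset.prod_ne_zero_iff.2 fun j _ => ((A j).charpoly_monic.map _).ne_zero)

theorem spec_eq_of_intertwining {𝕜 E F : Type*} [RCLike 𝕜] [Algebra 𝕜 ℂ]
    [AddCommGroup E] [Module 𝕜 E] [Module.Finite 𝕜 E]
    [AddCommGroup F] [Module 𝕜 F] [Module.Finite 𝕜 F]
    (e : E ≃ₗ[𝕜] F) {A : Module.End 𝕜 E} {B : Module.End 𝕜 F} (h : ∀ x, B (e x) = e (A x)) :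
    spec B = spec A := by
  have hB : B = e.conj A := LinearMap.ext fun y => by
    rw [LinearEquiv.conj_apply_apply, ← h, e.apply_symm_apply]
  rw [hB, spec, spec, LinearEquiv.charpoly_conj]

theorem exists_basis_of_span_eq_top {k : ℕ} [NeZero k] {R E : Type*} [DivisionRing R]
    [AddCommGroup E] [Module R E] (hk : Module.finrank R E = k) {t : Set E}
    (ht : Submodule.span R t = ⊤) {x : E} (hx : x ≠ 0) (hxt : x ∈ t) :
    ∃ b : Module.Basis (Fin k) R E, b 0 = x ∧ ∀ j, b j ∈ t := by
  have : Module.Finite R E := Module.finite_of_finrank_pos (hk ▸ Nat.pos_of_neZero k)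
  have hs : LinearIndepOn R id {x} := .singleton hx
  have hst : {x} ⊆ t := Set.singleton_subset_iff.2 hxt
  let b := Module.Basis.extendLe hs hst ht.ge
  obtain ⟨o, ho⟩ : x ∈ Set.range b := Module.Basis.subset_extendLe hs hst ht.ge rfl
  have := Module.Finite.finite_basis b
  let e₀ := Finite.equivFinOfCardEq ((Module.finrank_eq_nat_card_basis b).symm.trans hk)
  let e := e₀.trans (Equiv.swap (e₀ o) 0)
  have he : e.symm 0 = o := by simp [e]
  refine ⟨b.reindex e, ?_, fun j => ?_⟩
  · rw [Module.Basis.reindex_apply, he, ho]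
  · rw [Module.Basis.reindex_apply]
    exact Module.Basis.extendLe_subset hs hst ht.ge (Set.mem_range_self _)

end LinearAlgebra

section Characters

theorem apply_sum_character_smul {R G E : Type*} [CommRing R] [Group G] [Fintype G]
    [AddCommGroup E] [Module R E] (ρ : Representation R G E) (χ : G →* Rˣ) (g : G) (v : E) :
    ρ g (∑ h, (χ h)⁻¹ • ρ h v) = χ g • ∑ h, (χ h)⁻¹ • ρ h v := by
  rw [map_sum, Finset.smul_sum, ← Equiv.sum_comp (Equiv.mulLeft g) fun h => χ g • (χ h)⁻¹ • ρ h v]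
  refine Finset.sum_congr rfl fun h _ => ?_
  rw [Equiv.coe_mulLeft, map_mul, map_mul, mul_inv, smul_smul, mul_inv_cancel_left]
  exact map_smul (ρ g) ((χ h)⁻¹ : Rˣ).val _

theorem span_eigenvectors_eq_top {G E : Type*} [Group G] [IsMulCommutative G]
    [Finite G] [AddCommGroup E] [Module ℂ E] (ρ : Representation ℂ G E) :
    Submodule.span ℂ {v | ∃ χ : G →* ℂˣ, ∀ g, ρ g v = χ g • v} = ⊤ := by
  classical
  let : CommGroup G := IsMulCommutative.instCommGroup
  have := Fintype.ofFinite G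
  refine Submodule.eq_top_iff'.2 fun v => ?_
  let χ (ψ : AddChar (Additive G) ℂ) : G →* ℂˣ := (MonoidHom.toHomUnits ψ.toMonoidHom)⁻¹
  have inv_smul (ψ) (h : G) : (χ ψ h)⁻¹ • ρ h v = ψ (.ofMul h) • ρ h v := by
    rw [MonoidHom.inv_apply, inv_inv]
    rfl
  have fourier_inversion : ∑ ψ, ∑ h, (χ ψ h)⁻¹ • ρ h v = (Fintype.card G : ℂ) • v := by
    simp_rw [inv_smul]
    rw [Finset.sum_comm]
    simp_rw [← Finset.sum_smul, AddChar.sum_apply_eq_ite, ofMul_eq_zero]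
    simp
  have hcard : (Fintype.card G : ℂ) ≠ 0 := mod_cast Fintype.card_ne_zero
  rw [← Submodule.smul_mem_iff _ hcard, ← fourier_inversion]
  exact Submodule.sum_mem _ fun ψ _ => Submodule.subset_span
    ⟨χ ψ, fun g => apply_sum_character_smul ρ (χ ψ) g v⟩

theorem conj_character_mul_self {G : Type*} [Group G] [Finite G] (χ : G →* ℂˣ) (g : G) :
    (starRingEnd ℂ) (χ g : ℂ) * χ g = 1 := by
  have hpow : (χ g : ℂ) ^ Nat.card G = 1 := by
    rw [← Units.val_pow_eq_pow_val, ← map_pow, pow_card_eq_one', map_one, Units.val_one]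
  rw [Complex.conj_mul', Complex.norm_eq_one_of_pow_eq_one hpow Nat.card_pos.ne']
  simp

variable {k : ℕ}

theorem permMat_mulVec (g : Equiv.Perm (Fin k)) (v : Fin k → ℂ) :
    permMat g *ᵥ v = v ∘ g.symm := by
  funext a
  simp [permMat, Matrix.mulVec, dotProduct, ← Equiv.symm_apply_eq]

theorem mul_permMat_apply (A : Matrix (Fin k) (Fin k) ℂ) (g : Equiv.Perm (Fin k)) (j b : Fin k) :
    (A * permMat g) j b = A j (g b) := by
  simp [permMat, Matrix.mul_apply]

/-- The permutation representation of `H` on `ℂ^k`, given by the matrices `permMat g`. -/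
def permRep (H : Subgroup (Equiv.Perm (Fin k))) : Representation ℂ H (Fin k → ℂ) where
  toFun g := (permMat (g : Equiv.Perm (Fin k))).mulVecLin
  map_one' := LinearMap.ext fun v => permMat_mulVec 1 v
  map_mul' g h := LinearMap.ext fun v => by
    simp only [Module.End.mul_apply, Matrix.mulVecLin_apply, permMat_mulVec]
    rfl

theorem permRep_const_one {H : Subgroup (Equiv.Perm (Fin k))} (g : H) : permRep H g 1 = 1 :=
  permMat_mulVec (g : Equiv.Perm (Fin k)) 1

variable [NeZero k] {H : Subgroup (Equiv.Perm (Fin k))} {ϱ : Fin k → (H →* ℂˣ)}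

theorem isDecomposition_of_eigenbasis (h_one : ϱ 0 = 1) (b : Module.Basis (Fin k) ℂ (Fin k → ℂ))
    (hb : ∀ j g, permRep H g (b j) = ϱ j g • b j) : IsDecomposition H ϱ := by
  let T := (Pi.basisFun ℂ (Fin k)).toMatrix b
  let := (Pi.basisFun ℂ (Fin k)).invertibleToMatrix b
  have hT : IsUnit T := isUnit_of_invertible T
  refine ⟨h_one, T, hT, fun g => ?_⟩
  have diagonalized : permMat (g : Equiv.Perm (Fin k)) * T =
      T * Matrix.diagonal fun j => (ϱ j g : ℂ) := by
    ext a j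
    rw [Matrix.mul_diagonal, mul_comm]
    exact congrFun (hb j g) a
  rw [mul_assoc, diagonalized,
    Matrix.nonsing_inv_mul_cancel_left _ _ ((Matrix.isUnit_iff_isUnit_det T).1 hT)]

theorem exists_isDecomposition [IsMulCommutative H] :
    ∃ ϱ : Fin k → (H →* ℂˣ), IsDecomposition H ϱ := by
  obtain ⟨b, hb_zero, hb⟩ := exists_basis_of_span_eq_top (Module.finrank_fin_fun ℂ)
    (span_eigenvectors_eq_top (permRep H)) one_ne_zero
    ⟨1, fun g => by rw [permRep_const_one, MonoidHom.one_apply, one_smul]⟩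
  choose χ hχ using hb
  refine ⟨χ, isDecomposition_of_eigenbasis ?_ b hχ⟩
  ext g
  have fixed : 1 = χ 0 g • (1 : Fin k → ℂ) := by
    rw [← hb_zero, ← hχ 0 g, hb_zero, permRep_const_one]
  simpa [Units.smul_def] using (congrFun fixed 0).symm

/-- The rows of `S` indexed by `g b` and `b` differ by the values at `g` of the characters `ϱ j`
indexing the columns: combining functions with the coefficients `S` turns translation by `H` into
multiplication by characters. -/
def IsEquivariant {ι κ : Type*} (H : Subgroup (Equiv.Perm ι)) (ϱ : κ → (H →* ℂˣ))
    (S : Matrix ι κ ℂ) : Prop :=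
  ∀ (g : H) b j, S ((g : Equiv.Perm ι) b) j = ϱ j g * S b j

theorem IsDecomposition.exists_isEquivariant (h : IsDecomposition H ϱ) :
    ∃ S : Matrix (Fin k) (Fin k) ℂ, IsUnit S ∧ IsEquivariant H ϱ S := by
  obtain ⟨-, T, hT, hdiag⟩ := h
  have hdet := (Matrix.isUnit_iff_isUnit_det _).1 hT
  refine ⟨T⁻¹ᵀ, (Matrix.isUnit_transpose _).2 (Matrix.isUnit_nonsing_inv_iff.2 hT), fun g b j => ?_⟩
  have intertwined : T⁻¹ * permMat (g : Equiv.Perm (Fin k)) =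
      Matrix.diagonal (fun j => (ϱ j g : ℂ)) * T⁻¹ := by
    rw [← hdiag g, Matrix.mul_nonsing_inv_cancel_right _ _ hdet]
  simpa only [mul_permMat_apply, Matrix.diagonal_mul, Matrix.transpose_apply] using
    congrFun₂ intertwined j b

end Characters

section Cochains

variable {𝕜 : Type*} [RCLike 𝕜] {V : Type*} [DecidableEq V]
variable {K : PreAbstractSimplicialComplex V} {n : ℕ}

theorem OrdSimplex.mem_face (v : OrdSimplex K n) (t : Fin n) : v.1 t ∈ v.face.1 :=
  Finset.mem_image_of_mem _ (mem_univ _)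

theorem IncidenceWeight.one_ofReal (F : Face K n) (G : Face K (n + 1)) :
    (((IncidenceWeight.one ℝ K n).toFun F G : ℝ) : ℂ) = (IncidenceWeight.one ℂ K n).toFun F G := by
  simp only [one, apply_ite Complex.ofReal, Complex.ofReal_one, Complex.ofReal_zero]

variable [Fintype V]

theorem OrdSimplex.reorder_reorder (v : OrdSimplex K n) (σ τ : Equiv.Perm (Fin n)) :
    (v.reorder σ).reorder τ = v.reorder (σ * τ) := rfl

theorem OrdSimplex.reorder_injective (v : OrdSimplex K n) : Function.Injective v.reorder :=
  fun _ _ h => Equiv.ext fun a => v.2.1 (congrFun (congrArg Subtype.val h) a)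

/-- The permutation that takes the chosen orientation of a face to a given ordering of it. -/
def OrdSimplex.perm (v : OrdSimplex K n) : Equiv.Perm (Fin n) :=
  (exists_reorder v.face.oriented v (Face.face_oriented _).symm).choose

theorem OrdSimplex.oriented_reorder_perm (v : OrdSimplex K n) :
    v.face.oriented.reorder v.perm = v :=
  (exists_reorder v.face.oriented v (Face.face_oriented _).symm).choose_spec

theorem OrdSimplex.perm_reorder (v : OrdSimplex K n) (σ : Equiv.Perm (Fin n)) :
    (v.reorder σ).perm = v.perm * σ := by
  apply v.face.oriented.reorder_injective
  rw [← reorder_reorder, v.oriented_reorder_perm]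
  simpa only [face_reorder] using (v.reorder σ).oriented_reorder_perm

theorem Face.perm_oriented (F : Face K n) : F.oriented.perm = 1 := by
  apply F.oriented.reorder_injective
  have h := F.oriented.oriented_reorder_perm
  rw [face_oriented] at h
  exact h

theorem Cochain.apply_eq (f : Cochain 𝕜 K n) (v : OrdSimplex K n) :
    f.1 v = ((Equiv.Perm.sign v.perm : ℤ) : 𝕜) * f.1 v.face.oriented := by
  rw [← f.2, v.oriented_reorder_perm]

variable (𝕜 K n)

/-- A cochain is determined by its values on the oriented faces, which are arbitrary. -/
def Cochain.equivFun : Cochain 𝕜 K n ≃ₗ[𝕜] (Face K n → 𝕜) where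
  toFun f F := f.1 F.oriented
  map_add' _ _ := rfl
  map_smul' _ _ := rfl
  invFun c := ⟨fun v => ((Equiv.Perm.sign v.perm : ℤ) : 𝕜) * c v.face, fun v σ => by
    beta_reduce
    rw [OrdSimplex.perm_reorder, OrdSimplex.face_reorder, Equiv.Perm.sign_mul]
    push_cast
    ring⟩
  left_inv f := Subtype.ext (funext fun v => (Cochain.apply_eq f v).symm)
  right_inv c := funext fun F => by simp [Face.perm_oriented, Face.face_oriented]

/-- The basis of the cochain group dual to the oriented faces. -/
def Cochain.basis : Module.Basis (Face K n) 𝕜 (Cochain 𝕜 K n) :=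
  Module.Basis.ofEquivFun (Cochain.equivFun 𝕜 K n)

theorem Cochain.finrank_eq_card_face :
    Module.finrank 𝕜 (Cochain 𝕜 K n) = Fintype.card (Face K n) :=
  Module.finrank_eq_card_basis (Cochain.basis 𝕜 K n)

variable {𝕜 K n}

/-- A real cochain regarded as a complex one. -/
def Cochain.complexify (f : Cochain ℝ K n) : Cochain ℂ K n :=
  ⟨fun v => (f.1 v : ℂ), fun v σ => by
    beta_reduce
    rw [f.2 v σ]
    push_cast
    rfl⟩

theorem Cochain.basis_repr_complexify (f : Cochain ℝ K n) (F : Face K n) :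
    (Cochain.basis ℂ K n).repr (Cochain.complexify f) F = ((Cochain.basis ℝ K n).repr f F : ℂ) :=
  rfl

theorem Cochain.complexify_basis (F : Face K n) :
    Cochain.complexify (Cochain.basis ℝ K n F) = Cochain.basis ℂ K n F := by
  apply (Cochain.basis ℂ K n).repr.injective
  ext G
  rw [basis_repr_complexify, Module.Basis.repr_self, Module.Basis.repr_self]
  by_cases h : F = G <;> simp [h]

theorem weightedDownLaplacian_complexify (w : Finset V → ℝ) (f : Cochain ℝ K (n + 1)) :
    weightedDownLaplacian K n w (IncidenceWeight.one ℂ K n) (Cochain.complexify f) =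
      Cochain.complexify (downLaplacian K n w f) := by
  apply Subtype.ext
  funext v
  simp [weightedDownLaplacian, downLaplacian, coboundary, adjointCoboundary, Cochain.complexify,
    ← IncidenceWeight.one_ofReal]

theorem spec_downLaplacian (K : PreAbstractSimplicialComplex V) (i : ℕ) (w : Finset V → ℝ) :
    spec (downLaplacian K i w) =
      spec (weightedDownLaplacian K i w (IncidenceWeight.one ℂ K i)) := by
  have toMatrix_eq : LinearMap.toMatrix (Cochain.basis ℂ K (i + 1)) (Cochain.basis ℂ K (i + 1))
      (weightedDownLaplacian K i w (IncidenceWeight.one ℂ K i)) =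
      (LinearMap.toMatrix (Cochain.basis ℝ K (i + 1)) (Cochain.basis ℝ K (i + 1))
        (downLaplacian K i w)).map (algebraMap ℝ ℂ) := by
    ext F G
    rw [Matrix.map_apply, LinearMap.toMatrix_apply, LinearMap.toMatrix_apply,
      ← Cochain.complexify_basis, weightedDownLaplacian_complexify, Cochain.basis_repr_complexify]
    rfl
  unfold spec
  rw [← LinearMap.charpoly_toMatrix _ (Cochain.basis ℂ K (i + 1)), toMatrix_eq,
    ← LinearMap.charpoly_toMatrix _ (Cochain.basis ℝ K (i + 1)), Matrix.charpoly_map]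
  simp [Polynomial.aroots]

end Cochains

section Sheets

variable {𝕜 : Type*} [RCLike 𝕜] {V W : Type*} [DecidableEq W]
variable {K : PreAbstractSimplicialComplex V} {M : PreAbstractSimplicialComplex W}
variable {φ : V → W} {n : ℕ} {ι κ : Type*}

variable (K M φ n ι) in
/-- A labelling of the simplices of `K` with `n` vertices by a simplex of `M` and a sheet in `ι`,
for which `φ` forgets the sheet. -/
structure Sheets where
  /-- The simplex over a given simplex of `M` that lies in a given sheet. -/
  equiv : Face M n × ι ≃ Face K n
  image_equiv : ∀ x, (equiv x).1.image φ = x.1.1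

namespace Sheets

theorem image_face (e : Sheets K M φ n ι) (F : Face K n) :
    F.1.image φ = (e.equiv.symm F).1.1 := by
  rw [← e.image_equiv, e.equiv.apply_symm_apply]

theorem injOn (e : Sheets K M φ n ι) (F : Face K n) : Set.InjOn φ F.1 :=
  Finset.card_image_iff.1 (by rw [e.image_face, (e.equiv.symm F).1.2.2, F.2.2])

variable [DecidableEq V]

/-- The image under `φ` of an ordered simplex of `K`. -/
def map (e : Sheets K M φ n ι) (v : OrdSimplex K n) : OrdSimplex M n :=
  ⟨φ ∘ v.1, fun _ _ h => v.2.1 (e.injOn v.face (v.mem_face _) (v.mem_face _) h), by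
    rw [← Finset.image_image]
    exact e.image_face v.face ▸ (e.equiv.symm v.face).1.2.1⟩

/-- The sheet that contains an ordered simplex of `K`. -/
def sheet (e : Sheets K M φ n ι) (v : OrdSimplex K n) : ι :=
  (e.equiv.symm v.face).2

theorem coe_map_face (e : Sheets K M φ n ι) (v : OrdSimplex K n) :
    (e.map v).face.1 = v.face.1.image φ :=
  (Finset.image_image (f := v.1) (s := univ)).symm

theorem map_face (e : Sheets K M φ n ι) (v : OrdSimplex K n) :
    (e.map v).face = (e.equiv.symm v.face).1 :=
  Subtype.ext ((e.coe_map_face v).trans (e.image_face v.face))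

theorem face_eq (e : Sheets K M φ n ι) (v : OrdSimplex K n) :
    v.face = e.equiv ((e.map v).face, e.sheet v) := by
  rw [map_face, sheet, Prod.mk.eta, e.equiv.apply_symm_apply]

variable [Fintype V]

theorem sheet_reorder (e : Sheets K M φ n ι) (v : OrdSimplex K n) (σ : Equiv.Perm (Fin n)) :
    e.sheet (v.reorder σ) = e.sheet v := by
  rw [sheet, OrdSimplex.face_reorder, sheet]

variable [Fintype W]

theorem map_reorder (e : Sheets K M φ n ι) (v : OrdSimplex K n) (σ : Equiv.Perm (Fin n)) :
    e.map (v.reorder σ) = (e.map v).reorder σ := rfl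

theorem map_omit_vertex (e : Sheets K M φ n ι) (e' : Sheets K M φ (n + 1) ι)
    (v : OrdSimplex K (n + 1)) (t : Fin (n + 1)) :
    e.map (v.omit_vertex t) = (e'.map v).omit_vertex t := rfl

theorem map_sheet_bijective (e : Sheets K M φ n ι) :
    Function.Bijective fun v => (e.map v, e.sheet v) := by
  refine ⟨fun v x h => ?_, fun ⟨u, a⟩ => ?_⟩
  · obtain ⟨hmap, hsheet⟩ := Prod.mk.inj h
    have hface : v.face = x.face := by rw [e.face_eq v, e.face_eq x, hmap, hsheet]
    refine Subtype.ext (funext fun t => e.injOn v.face (v.mem_face t) ?_ ?_)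
    · exact hface ▸ x.mem_face t
    · exact congrFun (congrArg Subtype.val hmap) t
  · let v := (e.equiv (u.face, a)).oriented
    have hv : e.equiv.symm v.face = (u.face, a) := by
      rw [Face.face_oriented, e.equiv.symm_apply_apply]
    obtain ⟨σ, hσ⟩ := exists_reorder (e.map v) u (by rw [map_face, hv])
    exact ⟨v.reorder σ, Prod.ext hσ ((e.sheet_reorder v σ).trans (congrArg Prod.snd hv))⟩

/-- The cochain of `K` that on the sheet `b` is the combination of the cochains `f j` of `M` with
the coefficients `S b j`. -/
def combine [Fintype κ] (e : Sheets K M φ n ι) (S : Matrix ι κ 𝕜) :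
    (κ → Cochain 𝕜 M n) →ₗ[𝕜] Cochain 𝕜 K n where
  toFun f := ⟨fun v => ∑ j, S (e.sheet v) j * (f j).1 (e.map v), fun v σ => by
    simp only [sheet_reorder, map_reorder, (f _).2 _ σ, Finset.mul_sum]
    exact Finset.sum_congr rfl fun j _ => mul_left_comm _ _ _⟩
  map_add' f g := Subtype.ext (funext fun v => by simp [mul_add, Finset.sum_add_distrib])
  map_smul' c f := Subtype.ext (funext fun v => by simp [Finset.mul_sum, mul_left_comm])

theorem combine_apply [Fintype κ] (e : Sheets K M φ n ι) (S : Matrix ι κ 𝕜)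
    (f : κ → Cochain 𝕜 M n) (v : OrdSimplex K n) :
    (e.combine S f).1 v = ∑ j, S (e.sheet v) j * (f j).1 (e.map v) := rfl

variable [Fintype ι] [DecidableEq ι] {S : Matrix ι ι 𝕜}

theorem combine_injective (e : Sheets K M φ n ι) (hS : IsUnit S) :
    Function.Injective (e.combine S) := by
  refine (injective_iff_map_eq_zero _).2 fun f hf => ?_
  refine funext fun j => Subtype.ext (funext fun u => ?_)
  have mulVec_eq_zero : S *ᵥ (fun j => (f j).1 u) = 0 := funext fun a => by
    obtain ⟨v, hv⟩ := e.map_sheet_bijective.2 (u, a)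
    obtain ⟨rfl, rfl⟩ := Prod.mk.inj hv
    exact congrFun (congrArg Subtype.val hf) v
  exact congrFun (Matrix.mulVec_injective_of_isUnit hS
    (mulVec_eq_zero.trans (Matrix.mulVec_zero S).symm)) j

theorem combine_bijective (e : Sheets K M φ n ι) (hS : IsUnit S) :
    Function.Bijective (e.combine S) := by
  have hfinrank : Module.finrank 𝕜 (ι → Cochain 𝕜 M n) = Module.finrank 𝕜 (Cochain 𝕜 K n) := by
    rw [Module.finrank_pi_fintype, Finset.sum_const, Cochain.finrank_eq_card_face,
      Cochain.finrank_eq_card_face, ← Fintype.card_congr e.equiv, Fintype.card_prod, card_univ,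
      smul_eq_mul, mul_comm]
  exact ⟨e.combine_injective hS,
    (LinearMap.injective_iff_surjective_of_finrank_eq_finrank hfinrank).1 (e.combine_injective hS)⟩

end Sheets

end Sheets

section IncidenceWeights

variable {W : Type*} [DecidableEq W] {M : PreAbstractSimplicialComplex W} {n k : ℕ}
variable {ψ : Voltage (incidenceGraph M n) k}

theorem IncidenceWeight.one_apply {F : Face M n} {G : Face M (n + 1)} (h : F.1 ⊆ G.1) :
    (IncidenceWeight.one ℂ M n).toFun F G = 1 :=
  if_pos h

theorem Voltage.weight_apply (χ : ψ.group →* ℂˣ) {F : Face M n} {G : Face M (n + 1)}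
    (h : F.1 ⊆ G.1) :
    (ψ.weight χ).toFun F G =
      χ ⟨ψ.incidence F G h, Subgroup.subset_closure ⟨F, G, h, rfl⟩⟩ :=
  dif_pos h

theorem Voltage.weight_one : ψ.weight 1 = IncidenceWeight.one ℂ M n := by
  simp [weight, IncidenceWeight.one]

theorem conj_weight_mul_self (χ : ψ.group →* ℂˣ) {F : Face M n} {G : Face M (n + 1)}
    (h : F.1 ⊆ G.1) :
    (starRingEnd ℂ) ((ψ.weight χ).toFun F G) * (ψ.weight χ).toFun F G = 1 := by
  rw [ψ.weight_apply χ h, conj_character_mul_self]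

end IncidenceWeights

section Intertwining

variable {V W : Type*} [Fintype V] [DecidableEq V] [Fintype W] [DecidableEq W]
variable {K : PreAbstractSimplicialComplex V} {M : PreAbstractSimplicialComplex W} {φ : V → W}
variable {n k : ℕ} {ψ : Voltage (incidenceGraph M n) k}
variable {e : Sheets K M φ n (Fin k)} {e' : Sheets K M φ (n + 1) (Fin k)}

/-- The incidences between simplices of `K` of consecutive dimensions, labelled by sheets, are the
edges of the derived graph of `ψ`. -/
def IsDerived (ψ : Voltage (incidenceGraph M n) k) (e : Sheets K M φ n (Fin k))
    (e' : Sheets K M φ (n + 1) (Fin k)) : Prop :=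
  ∀ F a G b, (e.equiv (F, a)).1 ⊆ (e'.equiv (G, b)).1 ↔ ∃ h, a = ψ.incidence F G h b

theorem IsDerived.sheet_omit_vertex (h : IsDerived ψ e e') (x : OrdSimplex K (n + 1))
    (t : Fin (n + 1)) :
    e.sheet (x.omit_vertex t) =
      ψ.incidence _ _ ((e'.map x).face_omit_subset t) (e'.sheet x) := by
  have hsub := x.face_omit_subset t
  rw [e'.face_eq x, e.face_eq (x.omit_vertex t), h] at hsub
  exact hsub.2

theorem IsDerived.bijOn_map (h : IsDerived ψ e e') (v : OrdSimplex K n) (t : Fin (n + 1)) :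
    Set.BijOn e'.map {x | x.omit_vertex t = v} {u | u.omit_vertex t = e.map v} := by
  refine ⟨fun x hx => congrArg e.map hx, fun x hx y hy hxy => ?_, fun u hu => ?_⟩
  · have sheet_eq := (congrArg e.sheet hx).trans (congrArg e.sheet hy).symm
    rw [h.sheet_omit_vertex, h.sheet_omit_vertex] at sheet_eq
    simp only [hxy, EmbeddingLike.apply_eq_iff_eq] at sheet_eq
    exact e'.map_sheet_bijective.1 (Prod.ext hxy sheet_eq)
  · obtain ⟨x, hx⟩ := e'.map_sheet_bijective.2
      (u, (ψ.incidence _ _ (u.face_omit_subset t))⁻¹ (e.sheet v))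
    obtain ⟨rfl, hsheet⟩ := Prod.mk.inj hx
    refine ⟨x, e.map_sheet_bijective.1 (Prod.ext hu ?_), rfl⟩
    exact (h.sheet_omit_vertex x t).trans ((Equiv.Perm.eq_inv_iff_eq).1 hsheet)

variable {κ : Type*} {ϱ : κ → (ψ.group →* ℂˣ)} {S : Matrix (Fin k) κ ℂ}

theorem IsDerived.coeff_omit_vertex (h : IsDerived ψ e e') (hS : IsEquivariant ψ.group ϱ S)
    (x : OrdSimplex K (n + 1)) (t : Fin (n + 1)) (j : κ) :
    S (e.sheet (x.omit_vertex t)) j =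
      (ψ.weight (ϱ j)).toFun ((e'.map x).omit_vertex t).face (e'.map x).face *
        S (e'.sheet x) j := by
  rw [h.sheet_omit_vertex, ψ.weight_apply _ ((e'.map x).face_omit_subset t), ← hS]

variable [Fintype κ]

theorem IsDerived.coboundary_combine (h : IsDerived ψ e e') (hS : IsEquivariant ψ.group ϱ S)
    (f : κ → Cochain ℂ M n) :
    coboundary (IncidenceWeight.one ℂ K n) (e.combine S f) =
      e'.combine S fun j => coboundary (ψ.weight (ϱ j)) (f j) := by
  refine Subtype.ext (funext fun x => ?_)
  simp only [coboundary, LinearMap.coe_mk, AddHom.coe_mk, Sheets.combine_apply,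
    IncidenceWeight.one_apply (x.face_omit_subset _), h.coeff_omit_vertex hS,
    e.map_omit_vertex e', Finset.mul_sum]
  rw [Finset.sum_comm]
  exact Finset.sum_congr rfl fun j _ => Finset.sum_congr rfl fun t _ => by ring

theorem IsDerived.adjointCoboundary_combine (h : IsDerived ψ e e')
    (hS : IsEquivariant ψ.group ϱ S) {wK : Finset V → ℝ} {wM : Finset W → ℝ}
    (hw : ∀ F : Face K n, wK F.1 = wM (F.1.image φ))
    (hw' : ∀ F : Face K (n + 1), wK F.1 = wM (F.1.image φ)) (f : κ → Cochain ℂ M (n + 1)) :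
    adjointCoboundary wK (IncidenceWeight.one ℂ K n) (e'.combine S f) =
      e.combine S fun j => adjointCoboundary wM (ψ.weight (ϱ j)) (f j) := by
  refine Subtype.ext (funext fun v => ?_)
  simp only [adjointCoboundary, LinearMap.coe_mk, AddHom.coe_mk, Sheets.combine_apply,
    Finset.mul_sum]
  symm
  rw [Finset.sum_comm]
  symm
  have lifting : Set.BijOn e'.map
      ({x | x.omit_vertex 0 = v} : Finset (OrdSimplex K (n + 1)))
      ({u | u.omit_vertex 0 = e.map v} : Finset (OrdSimplex M (n + 1))) := by
    simpa only [Finset.coe_filter_univ] using h.bijOn_map v 0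
  refine Finset.sum_nbij e'.map (fun x hx => lifting.mapsTo hx) lifting.injOn lifting.surjOn
    fun x hx => Finset.sum_congr rfl fun j _ => ?_
  obtain rfl := (Finset.mem_filter.1 hx).2
  rw [h.coeff_omit_vertex hS, IncidenceWeight.one_apply (x.face_omit_subset 0), map_one,
    e.map_omit_vertex e', hw, hw', ← e.coe_map_face, ← e'.coe_map_face, e.map_omit_vertex e']
  linear_combination
    -((wM (e'.map x).face.1 / wM ((e'.map x).omit_vertex 0).face.1 : ℝ) : ℂ) *
      S (e'.sheet x) j * (f j).1 (e'.map x) *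
        conj_weight_mul_self (ϱ j) ((e'.map x).face_omit_subset 0)

theorem IsDerived.spec_weightedDownLaplacian (h : IsDerived ψ e e')
    {ϱ : Fin k → (ψ.group →* ℂˣ)} {S : Matrix (Fin k) (Fin k) ℂ} (hSunit : IsUnit S)
    (hS : IsEquivariant ψ.group ϱ S) {wK : Finset V → ℝ} {wM : Finset W → ℝ}
    (hw : ∀ F : Face K n, wK F.1 = wM (F.1.image φ))
    (hw' : ∀ F : Face K (n + 1), wK F.1 = wM (F.1.image φ)) :
    spec (weightedDownLaplacian K n wK (IncidenceWeight.one ℂ K n)) =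
      ∑ j, spec (weightedDownLaplacian M n wM (ψ.weight (ϱ j))) := by
  rw [← spec_pi]
  refine spec_eq_of_intertwining (.ofBijective _ (e'.combine_bijective hSunit)) fun f => ?_
  simp only [LinearEquiv.ofBijective_apply, weightedDownLaplacian, LinearMap.comp_apply,
    h.adjointCoboundary_combine hS hw hw', h.coboundary_combine hS]
  rfl

end Intertwining

section DerivedGraph

section IncidenceGraph

variable {V : Type*} {K : PreAbstractSimplicialComplex V} {n i : ℕ}

theorem isFace_simplexOf (x : Face K i ⊕ Face K (i + 1)) : IsFace K (simplexOf x) := by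
  rcases x with F | F
  exacts [F.2.1, F.2.1]

theorem simplexOf_injective :
    Function.Injective (simplexOf : Face K i ⊕ Face K (i + 1) → Finset V) := by
  rintro (F | F) (G | G) h
  · exact congrArg Sum.inl (Subtype.ext h)
  · exact absurd (congrArg Finset.card h) (by simp [simplexOf, F.2.2, G.2.2])
  · exact absurd (congrArg Finset.card h) (by simp [simplexOf, F.2.2, G.2.2])
  · exact congrArg Sum.inr (Subtype.ext h)

theorem exists_simplexOf_eq (hn : n = i ∨ n = i + 1) (F : Face K n) :
    ∃ x : Face K i ⊕ Face K (i + 1), simplexOf x = F.1 := by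
  obtain rfl | rfl := hn
  exacts [⟨.inl F, rfl⟩, ⟨.inr F, rfl⟩]

theorem exists_facet (G : Face K (n + 1)) : ∃ F : Face K n, F.1 ⊆ G.1 := by
  obtain ⟨F, hF, hcard⟩ := Finset.exists_subset_card_eq (n.le_succ.trans_eq G.2.2.symm)
  have hface : IsFace K F := G.2.1.elim (fun hG => .inl (Finset.subset_empty.1 (hG ▸ hF)))
    fun hG => F.eq_empty_or_nonempty.imp_right ((K.isRelLowerSet_faces hG).2 hF)
  exact ⟨⟨F, hface, hcard⟩, hF⟩

end IncidenceGraph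

variable {V W : Type*} [DecidableEq W] {K : PreAbstractSimplicialComplex V}
variable {M : PreAbstractSimplicialComplex W} {φ : V → W}
variable {i k : ℕ} {ψ : Voltage (incidenceGraph M i) k} {η : derivedGraph ψ ≃g incidenceGraph K i}

theorem card_simplexOf_iso (hη : ∀ x, (simplexOf (η x)).image φ = simplexOf x.1)
    (x : (Face M i ⊕ Face M (i + 1)) × Fin k) :
    (simplexOf (η x)).card = (simplexOf x.1).card := by
  have card_le (y) : (simplexOf y.1).card ≤ (simplexOf (η y)).card := hη y ▸ Finset.card_image_le
  have hx := card_le x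
  obtain ⟨G | G, a⟩ := x <;> rcases hηx : η _ with F | F <;> rw [hηx] at hx
  · exact F.2.2.trans G.2.2.symm
  · -- A facet of `F` comes from a neighbour of `(G, a)`, which lies over a larger simplex.
    obtain ⟨F', hF'⟩ := exists_facet F
    obtain ⟨y, hy⟩ := η.surjective (.inl F')
    have hadj : (derivedGraph ψ).Adj y (.inl G, a) := by
      rw [← η.map_adj_iff, hy, hηx]
      exact hF'
    have hle := card_le y
    obtain ⟨G' | G', b⟩ := y
    · exact hadj.1.elim
    · rw [hy] at hle
      exact absurd (G'.2.2.symm.trans_le (hle.trans_eq F'.2.2)) (by simp)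
  · exact absurd (G.2.2.symm.trans_le (hx.trans_eq F.2.2)) (by simp)
  · exact F.2.2.trans G.2.2.symm

theorem exists_sheets (hη : ∀ x, (simplexOf (η x)).image φ = simplexOf x.1) {n : ℕ}
    (hn : n = i ∨ n = i + 1) :
    ∃ e : Sheets K M φ n (Fin k), ∀ x F a, simplexOf x = F.1 →
      simplexOf (η (x, a)) = (e.equiv (F, a)).1 := by
  choose vertex hvertex using exists_simplexOf_eq (K := M) hn
  let lift (x : Face M n × Fin k) : Face K n :=
    ⟨simplexOf (η (vertex x.1, x.2)), isFace_simplexOf _, by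
      rw [card_simplexOf_iso hη, hvertex, x.1.2.2]⟩
  have lift_injective : Function.Injective lift := fun x y h => by
    obtain ⟨hfst, hsnd⟩ := Prod.mk.inj (η.injective (simplexOf_injective (congrArg Subtype.val h)))
    exact Prod.ext (Subtype.ext (by rw [← hvertex, hfst, hvertex])) hsnd
  have lift_surjective : Function.Surjective lift := fun F => by
    obtain ⟨y, hy⟩ := exists_simplexOf_eq hn F
    obtain ⟨⟨x, a⟩, rfl⟩ := η.surjective y
    let G : Face M n := ⟨simplexOf x, isFace_simplexOf x, by
      rw [← card_simplexOf_iso hη (x, a), hy, F.2.2]⟩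
    have hG : vertex G = x := simplexOf_injective (hvertex G)
    exact ⟨(G, a), Subtype.ext (by rw [← hy, ← hG])⟩
  refine ⟨⟨.ofBijective lift ⟨lift_injective, lift_surjective⟩, fun x => ?_⟩, fun x F a h => ?_⟩
  · exact (hη _).trans (hvertex x.1)
  · rw [← hvertex F] at h
    rw [simplexOf_injective h]
    rfl

theorem exists_isDerived (hη : ∀ x, (simplexOf (η x)).image φ = simplexOf x.1) :
    ∃ (e : Sheets K M φ i (Fin k)) (e' : Sheets K M φ (i + 1) (Fin k)), IsDerived ψ e e' := by
  obtain ⟨e, he⟩ := exists_sheets hη (.inl rfl)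
  obtain ⟨e', he'⟩ := exists_sheets hη (.inr rfl)
  refine ⟨e, e', fun F a G b => ?_⟩
  have hF : η (.inl F, a) = .inl (e.equiv (F, a)) := simplexOf_injective (he _ F a rfl)
  have hG : η (.inr G, b) = .inr (e'.equiv (G, b)) := simplexOf_injective (he' _ G b rfl)
  have adj_iff := η.map_adj_iff (v := (.inl F, a)) (w := (.inr G, b))
  rw [hF, hG] at adj_iff
  exact adj_iff

end DerivedGraph

end CoverSpec

end

theorem mainTheorem8_general {V W : Type*} [Fintype V] [DecidableEq V] [Fintype W] [DecidableEq W]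
    (K : PreAbstractSimplicialComplex V) (M : PreAbstractSimplicialComplex W) (φ : V → W)
    (k : ℕ) [NeZero k] (wK : Finset V → ℝ) (wM : Finset W → ℝ)
    (hwK : ∀ F, CoverSpec.IsFace K F → 0 < wK F) (hwM : ∀ G, CoverSpec.IsFace M G → 0 < wM G)
    (i : ℕ)
    (hw : ∀ F, CoverSpec.IsFace K F → (F.card = i ∨ F.card = i + 1) → wK F = wM (F.image φ))
    (ψ : CoverSpec.Voltage (CoverSpec.incidenceGraph M i) k)
    (η : CoverSpec.derivedGraph ψ ≃g CoverSpec.incidenceGraph K i)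
    (hη : ∀ x, (CoverSpec.simplexOf (η x)).image φ = CoverSpec.simplexOf x.1)
    (hab : ∀ a ∈ ψ.group, ∀ b ∈ ψ.group, a * b = b * a) :
    (∃ ϱ : Fin k → (ψ.group →* ℂˣ), CoverSpec.IsDecomposition ψ.group ϱ) ∧
    ∀ ϱ : Fin k → (ψ.group →* ℂˣ), CoverSpec.IsDecomposition ψ.group ϱ →
      CoverSpec.spec (CoverSpec.downLaplacian K i wK) =
        CoverSpec.spec (CoverSpec.downLaplacian M i wM) +
          ∑ j ∈ Finset.univ.erase (0 : Fin k),
            CoverSpec.spec (CoverSpec.weightedDownLaplacian M i wM (ψ.weight (ϱ j))) := by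
  have : IsMulCommutative ψ.group := ⟨⟨fun a b => Subtype.ext (hab a a.2 b b.2)⟩⟩
  refine ⟨CoverSpec.exists_isDecomposition, fun ϱ hϱ => ?_⟩
  obtain ⟨e, e', hder⟩ := CoverSpec.exists_isDerived hη
  obtain ⟨S, hSunit, hS⟩ := hϱ.exists_isEquivariant
  rw [CoverSpec.spec_downLaplacian, CoverSpec.spec_downLaplacian,
    hder.spec_weightedDownLaplacian hSunit hS (fun F => hw F.1 F.2.1 (.inl F.2.2))
      fun F => hw F.1 F.2.1 (.inr F.2.2),
    ← Finset.add_sum_erase _ _ (Finset.mem_univ (0 : Fin k)), hϱ.1, CoverSpec.Voltage.weight_one]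

theorem mainTheorem8 {V W : Type*} [Fintype V] [DecidableEq V] [Fintype W] [DecidableEq W]
    (K : PreAbstractSimplicialComplex V) (M : PreAbstractSimplicialComplex W) (φ : V → W)
    (k : ℕ) [NeZero k] (hφ : CoverSpec.IsFoldCovering k K M φ)
    (wK : Finset V → ℝ) (wM : Finset W → ℝ)
    (hwK : ∀ F, CoverSpec.IsFace K F → 0 < wK F) (hwM : ∀ G, CoverSpec.IsFace M G → 0 < wM G)
    (i : ℕ)
    (hw : ∀ F, CoverSpec.IsFace K F → (F.card = i ∨ F.card = i + 1) → wK F = wM (F.image φ))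
    (ψ : CoverSpec.Voltage (CoverSpec.incidenceGraph M i) k)
    (η : CoverSpec.derivedGraph ψ ≃g CoverSpec.incidenceGraph K i)
    (hη : ∀ x, (CoverSpec.simplexOf (η x)).image φ = CoverSpec.simplexOf x.1)
    (hab : ∀ a ∈ ψ.group, ∀ b ∈ ψ.group, a * b = b * a) :
    (∃ ϱ : Fin k → (ψ.group →* ℂˣ), CoverSpec.IsDecomposition ψ.group ϱ) ∧
    ∀ ϱ : Fin k → (ψ.group →* ℂˣ), CoverSpec.IsDecomposition ψ.group ϱ →
      CoverSpec.spec (CoverSpec.downLaplacian K i wK) =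
        CoverSpec.spec (CoverSpec.downLaplacian M i wM) +
          ∑ j ∈ Finset.univ.erase (0 : Fin k),
            CoverSpec.spec (CoverSpec.weightedDownLaplacian M i wM (ψ.weight (ϱ j))) :=
  mainTheorem8_general K M φ k wK wM hwK hwM i hw ψ η hη hab
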